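/- Let $m\ge 0$, let $U\subset\mathbb R^2\times\mathbb R^{3m}$ be open, and let $f^\alpha\in C^\infty(U)$, $\alpha=1,\dots,m$. Let $\mathcal R^\infty$ be the infinite prolonged equation manifold of the system $$u^\alpha_{xy}=f^\alpha(x,y,u^\gamma,u^\gamma_x,u^\gamma_y),\qquad \alpha=1,\dots,m,$$ with coordinates $(x,y,u^\alpha,u^\alpha_x,u^\alpha_y,u^\alpha_{xx},u^\alpha_{yy},u^\alpha_{xxx},u^\alpha_{yyy},\dots)$, where $(x,y,u,u_x,u_y)\in U$. Functions and forms on $\mathcal R^\infty$ are smooth and of finite order. Let $D_x,D_y$ be the total derivatives on $\mathcal R^\infty$, let $\theta^\alpha,\theta^\alpha_x,\theta^\alpha_y,\theta^\alpha_{xx},\theta^\alpha_{yy},\dots$ be the contact forms, for instance $$\theta^\alpha=du^\alpha-u^\alpha_x\,dx-u^\alpha_y\,dy,\quad \theta^\alpha_x=du^\alpha_x-u^\alpha_{xx}\,dx-f^\alpha\,dy,\quad \theta^\alpha_y=du^\alpha_y-f^\alpha\,dx-u^\alpha_{yy}\,dy,$$ let $\Omega^{r,s}(\mathcal R^\infty)$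 be the space of forms of degree $r$ in $dx,dy$ and of degree $s$ in the contact forms, and let $d=d_H+d_V$ be the splitting of the exterior derivative into $d_H:\Omega^{r,s}\to\Omega^{r+1,s}$ and $d_V:\Omega^{r,s}\to\Omega^{r,s+1}$. Let $T_{\alpha\beta},S_{\alpha\beta},R_{\alpha\beta}\in C^\infty(\mathcal R^\infty)$ be such that the form $$\omega=\sum_{\alpha,\beta}(T_{\alpha\beta}\,dx+S_{\alpha\beta}\,dy)\wedge\theta^\alpha\wedge\theta^\beta+\sum_{\alpha,\beta}R_{\alpha\beta}\,(\theta^\alpha\wedge\theta^\beta_x\wedge dx-\theta^\beta\wedge\theta^\alpha_y\wedge dy)\in\Omega^{1,2}(\mathcal R^\infty)$$ satisfies $d\omega=0$. Let $\lambda=L\,dx\wedge dy$ and $\lambda'=L'\,dx\wedge dy$ with $L,L'\in C^\infty(U)$ functions of $(x,y,u^\gamma,u^\gamma_x,u^\gamma_y)$, and let $\eta,\eta'\in\Omega^{1,1}(\mathcal R^\infty)$ satisfy $$d_H\eta=d_V\lambda,\qquad d_H\eta'=d_V\lambda',\qquad d_V\eta=d_V\eta'=\omega .$$ Then $\lambda$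 and $\lambda'$ differ locally by a total divergence: for every convex open $V\subset U$ there is a form $\beta\in\Omega^{1,0}$ on the part of $\mathcal R^\infty$ over $V$ such that $\lambda'=\lambda+d_H\beta$ there. In particular, if $U$ is convex, for example $U=\mathbb R^2\times\mathbb R^{3m}$, then $\lambda'=\lambda+d_H\beta$ on $\mathcal R^\infty$ for some $\beta\in\Omega^{1,0}(\mathcal R^\infty)$. -/

import Mathlib

open scoped ContDiff

namespace FGordon

/-- The fibre coordinates on the infinite prolonged equation manifold `R^∞` of a system
`u^α_{xy} = f^α(x, y, u, u_x, u_y)`, `α = 1, …, m`. They also index the contact forms `θ^α`,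
`θ^α_x`, `θ^α_y`, `θ^α_{xx}`, `θ^α_{yy}`, … and the vertical vector fields `∂/∂u^α`, …

* `u α` is `u^α`;
* `ux α k` is the pure derivative of `u^α` of order `k + 1` in `x` (so `ux α 0` is `u^α_x`);
* `uy α k` is the pure derivative of `u^α` of order `k + 1` in `y`. -/
inductive Fib (m : ℕ) : Type
  | u (α : Fin m) : Fib m
  | ux (α : Fin m) (k : ℕ) : Fib m
  | uy (α : Fin m) (k : ℕ) : Fib m
  deriving DecidableEq

/-- All coordinates on `R^∞`: `Sum.inl 0` is `x`, `Sum.inl 1` is `y`, and `Sum.inr c` is the fibre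
coordinate `c`. -/
abbrev Coord (m : ℕ) : Type := Fin 2 ⊕ Fib m

/-- Points `(x, y, u, u_x, u_y, u_xx, u_yy, u_xxx, u_yyy, …)` of `R^∞`. -/
abbrev Jet (m : ℕ) : Type := Coord m → ℝ

/-- Points `(x, y, u, u_x, u_y)` of the first jet space `R² × R^{3m}`. -/
abbrev FirstJet (m : ℕ) : Type :=
  ℝ × ℝ × (Fin m → ℝ) × (Fin m → ℝ) × (Fin m → ℝ)

/-- The projection `R^∞ → J¹`. -/
def toFirstJet {m : ℕ} (p : Jet m) : FirstJet m :=
  (p (Sum.inl 0), p (Sum.inl 1), fun α => p (Sum.inr (Fib.u α)),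
    fun α => p (Sum.inr (Fib.ux α 0)), fun α => p (Sum.inr (Fib.uy α 0)))

/-- The part of `R^∞` lying over a set `U` of first jets. If the `f^α` are defined on the open set
`U`, then this is the infinite prolonged equation manifold. -/
def jetsOver {m : ℕ} (U : Set (FirstJet m)) : Set (Jet m) := {p | toFirstJet p ∈ U}

/-- `F ∈ C^∞(R^∞)` over `U`: over `U`, the function `F` factors through a smooth function of
finitely many of the jet coordinates (equivalently, of the jet coordinates up to some finite
order). The image of `jetsOver U` under the projection to these coordinates is open if `U` is. -/
def SmoothOver {m : ℕ} (U : Set (FirstJet m)) (F : Jet m → ℝ) : Prop :=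
  ∃ (s : Finset (Coord m)) (g : (s → ℝ) → ℝ),
    ContDiffOn ℝ ∞ g ((fun (p : Jet m) (c : s) => p c) '' jetsOver U) ∧
      ∀ p ∈ jetsOver U, F p = g (fun c : s => p c)

/-- The partial derivative `∂F/∂c` with respect to the coordinate `c`. -/
noncomputable def pd {m : ℕ} (c : Coord m) (F : Jet m → ℝ) (p : Jet m) : ℝ :=
  deriv (fun t : ℝ => F (Function.update p c t)) (p c)

/-- The derivative of `F` along the vector field `∂/∂x^i + ∑_c v_c ∂/∂c`, where `c` runs over the
fibre coordinates. For a function of finitely many coordinates the sum has finitely many nonzero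
terms. -/
noncomputable def along {m : ℕ} (i : Fin 2) (v : Fib m → Jet m → ℝ) (F : Jet m → ℝ)
    (p : Jet m) : ℝ :=
  pd (Sum.inl i) F p + ∑ᶠ c : Fib m, v c p * pd (Sum.inr c) F p

/-- The components of `D_x` along `u, u_x, u_xx, …` and `u_y`; those along `u_yy, u_yyy, …` are
replaced by `0`. This field differentiates functions of `x, y, u, u_y, u_x, u_xx, …` correctly. -/
def xCompAux {m : ℕ} (f : Fin m → FirstJet m → ℝ) : Fib m → Jet m → ℝ
  | Fib.u α => fun p => p (Sum.inr (Fib.ux α 0))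
  | Fib.ux α k => fun p => p (Sum.inr (Fib.ux α (k + 1)))
  | Fib.uy α 0 => fun p => f α (toFirstJet p)
  | Fib.uy _ (_ + 1) => fun _ => 0

/-- The components of `D_y` along `u, u_y, u_yy, …` and `u_x`; those along `u_xx, u_xxx, …` are
replaced by `0`. This field differentiates functions of `x, y, u, u_x, u_y, u_yy, …` correctly. -/
def yCompAux {m : ℕ} (f : Fin m → FirstJet m → ℝ) : Fib m → Jet m → ℝ
  | Fib.u α => fun p => p (Sum.inr (Fib.uy α 0))
  | Fib.uy α k => fun p => p (Sum.inr (Fib.uy α (k + 1)))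
  | Fib.ux α 0 => fun p => f α (toFirstJet p)
  | Fib.ux _ (_ + 1) => fun _ => 0

/-- `(D_x)^k f^α` on `R^∞`: a function of `x, y, u, u_y, u_x, u_xx, …` only. -/
noncomputable def xIter {m : ℕ} (f : Fin m → FirstJet m → ℝ) (α : Fin m) : ℕ → Jet m → ℝ
  | 0 => fun p => f α (toFirstJet p)
  | k + 1 => along 0 (xCompAux f) (xIter f α k)

/-- `(D_y)^k f^α` on `R^∞`: a function of `x, y, u, u_x, u_y, u_yy, …` only. -/
noncomputable def yIter {m : ℕ} (f : Fin m → FirstJet m → ℝ) (α : Fin m) : ℕ → Jet m → ℝ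
  | 0 => fun p => f α (toFirstJet p)
  | k + 1 => along 1 (yCompAux f) (yIter f α k)

/-- The components of the total derivatives `D_x` (`i = 0`) and `D_y` (`i = 1`) constrained to the
equation manifold: `comp f i c` is `D_i c` for the fibre coordinate `c`. Here
`D_x u_{y⋯y} = (D_y)^k f` and `D_y u_{x⋯x} = (D_x)^k f` for a derivative of order `k + 1`. -/
noncomputable def comp {m : ℕ} (f : Fin m → FirstJet m → ℝ) : Fin 2 → Fib m → Jet m → ℝ
  | 0, Fib.u α => fun p => p (Sum.inr (Fib.ux α 0))
  | 0, Fib.ux α k => fun p => p (Sum.inr (Fib.ux α (k + 1)))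
  | 0, Fib.uy α k => yIter f α k
  | 1, Fib.u α => fun p => p (Sum.inr (Fib.uy α 0))
  | 1, Fib.uy α k => fun p => p (Sum.inr (Fib.uy α (k + 1)))
  | 1, Fib.ux α k => xIter f α k

/-- The total derivatives `D_x` (`i = 0`) and `D_y` (`i = 1`) constrained to `R^∞`. -/
noncomputable def totalD {m : ℕ} (f : Fin m → FirstJet m → ℝ) (i : Fin 2) :
    (Jet m → ℝ) → Jet m → ℝ :=
  along i (comp f i)

/-- Forms of type `(r, s)` on `R^∞`, through their components in the coframe
`dx, dy, θ^α, θ^α_x, θ^α_y, …`: `ξ I C` is the value of `ξ` on the vector fields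
`D_{I 0}, …, D_{I (r-1)}, ∂/∂(C 0), …, ∂/∂(C (s-1))` of the dual frame. So
`ξ = (r! s!)⁻¹ ∑ ξ I C · dx^{I 0} ∧ ⋯ ∧ dx^{I (r-1)} ∧ θ^{C 0} ∧ ⋯ ∧ θ^{C (s-1)}`. -/
abbrev BiForm (m r s : ℕ) : Type :=
  (Fin r → Fin 2) → (Fin s → Fib m) → Jet m → ℝ

/-- `ξ ∈ Ω^{r,s}(R^∞)` over `U`: the components are smooth, alternating in each group of indices,
and only finitely many contact forms occur. -/
structure IsForm {m r s : ℕ} (U : Set (FirstJet m)) (ξ : BiForm m r s) : Prop where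
  smooth : ∀ I C, SmoothOver U (ξ I C)
  alt_hor : ∀ (σ : Equiv.Perm (Fin r)) I C, ∀ p ∈ jetsOver U,
    ξ (I ∘ σ) C p = (Equiv.Perm.sign σ : ℤ) * ξ I C p
  alt_vert : ∀ (σ : Equiv.Perm (Fin s)) I C, ∀ p ∈ jetsOver U,
    ξ I (C ∘ σ) p = (Equiv.Perm.sign σ : ℤ) * ξ I C p
  finite : ∃ t : Finset (Fib m), ∀ I C, (∃ l, C l ∉ t) → ∀ p ∈ jetsOver U, ξ I C p = 0

/-- Equality of forms over `U`. -/
def EqOver {m r s : ℕ} (U : Set (FirstJet m)) (ξ ξ' : BiForm m r s) : Prop :=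
  ∀ I C, ∀ p ∈ jetsOver U, ξ I C p = ξ' I C p

/-- The form `dx^{I 0} ∧ ⋯ ∧ dx^{I (r-1)} ∧ θ^{C 0} ∧ ⋯ ∧ θ^{C (s-1)}`. -/
noncomputable def basisForm {m r s : ℕ} (I : Fin r → Fin 2) (C : Fin s → Fib m) :
    BiForm m r s :=
  fun I' C' _ => (Matrix.of fun a b => if I a = I' b then (1 : ℝ) else 0).det *
    (Matrix.of fun a b => if C a = C' b then (1 : ℝ) else 0).det

/-- The product of a function and a form. -/
def smulForm {m r s : ℕ} (F : Jet m → ℝ) (ξ : BiForm m r s) : BiForm m r s :=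
  fun I C p => F p * ξ I C p

/-- The vertical differential: `d_V F = ∑_c ∂F/∂c θ^c` on functions, and all `d_V dx^i` and
`d_V θ^c` vanish. The sign `(-1)^r` comes from moving the new contact form behind the `dx^i`. -/
noncomputable def dV {m r s : ℕ} (ξ : BiForm m r s) : BiForm m r (s + 1) :=
  fun I C p => (-1) ^ r * ∑ k : Fin (s + 1),
    (-1) ^ (k : ℕ) * pd (Sum.inr (C k)) (ξ I (C ∘ k.succAbove)) p

/-- The Lie derivative of a form along `D_i`, which acts on the coframe by `dx^j ↦ 0` and
`θ^c ↦ d_V (D_i c) = ∑_e ∂(D_i c)/∂e θ^e`. -/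
noncomputable def lieD {m r s : ℕ} (f : Fin m → FirstJet m → ℝ) (i : Fin 2)
    (ξ : BiForm m r s) : BiForm m r s :=
  fun I C p => totalD f i (ξ I C) p +
    ∑ l : Fin s, ∑ᶠ e : Fib m,
      pd (Sum.inr (C l)) (comp f i e) p * ξ I (Function.update C l e) p

/-- The horizontal differential `d_H ξ = ∑_i dx^i ∧ L_{D_i} ξ`. So `d_H F = D_x F dx + D_y F dy`,
`d_H dx^i = 0`, and `d_H θ^c = ∑_i dx^i ∧ d_V (D_i c)`; for instance
`d_H θ^α_x = dx ∧ θ^α_{xx} + dy ∧ d_V f^α`. -/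
noncomputable def dH {m r s : ℕ} (f : Fin m → FirstJet m → ℝ) (ξ : BiForm m r s) :
    BiForm m (r + 1) s :=
  fun I C p => ∑ k : Fin (r + 1),
    (-1) ^ (k : ℕ) * lieD f (I k) ξ (I ∘ k.succAbove) C p

/-- The first-order Lagrangian form `L(x, y, u, u_x, u_y) dx ∧ dy`. -/
noncomputable def lagrangianForm {m : ℕ} (L : FirstJet m → ℝ) : BiForm m 2 0 :=
  smulForm (fun p => L (toFirstJet p)) (basisForm ![0, 1] ![])

/-- The type `(1,2)` form
`∑_{α,β} (T_{αβ} dx + S_{αβ} dy) ∧ θ^α ∧ θ^β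
  + ∑_{α,β} R_{αβ} (θ^α ∧ θ^β_x ∧ dx - θ^β ∧ θ^α_y ∧ dy)`.
Moving `dx` or `dy` past two contact forms does not change the sign. -/
noncomputable def omegaForm {m : ℕ} (T S R : Fin m → Fin m → Jet m → ℝ) : BiForm m 1 2 :=
  ∑ α : Fin m, ∑ β : Fin m,
    (smulForm (T α β) (basisForm ![0] ![Fib.u α, Fib.u β])
      + smulForm (S α β) (basisForm ![1] ![Fib.u α, Fib.u β])
      + smulForm (R α β) (basisForm ![0] ![Fib.u α, Fib.ux β 0]
          - basisForm ![1] ![Fib.u β, Fib.uy α 0]))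

/-- `dξ = 0` over `U`. As `d = d_H + d_V` with `d_H ξ` and `d_V ξ` of different types, this says
that both vanish. -/
def DClosed {m r s : ℕ} (f : Fin m → FirstJet m → ℝ) (U : Set (FirstJet m))
    (ξ : BiForm m r s) : Prop :=
  EqOver U (dH f ξ) 0 ∧ EqOver U (dV ξ) 0

end FGordon

-- The difference `η' - η` is killed by `d_V`, because both forms have vertical differential `ω`.
-- The vertical Poincaré lemma over a convex `V` gives functions `B 0`, `B 1` whose fibre
-- derivatives are the components of `η' - η`. With `B = B 0 dx + B 1 dy` this says `η' - η = -d_V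
-- B`, the sign coming from moving contact forms past `dx` and `dy`. As `d_H` and `d_V` anticommute,
-- `d_V (λ' - λ) = d_H (η' - η) = d_V d_H B`. So the coefficient `H` of `λ' - λ - d_H B` has no
-- fibre derivatives; it is a function of `x` and `y` alone, and `H = D_x G` for some `G` of the
-- same kind. Then `β = B + G dy` works.
--
-- Anticommutation enters only through `pd_along`: the fibre derivative of `D_i F` is the Lie
-- derivative along `D_i` of `d_V F`.
--
-- Both primitives come from `exists_primitive`, a Poincaré lemma in some of the coordinates with
-- the others as parameters. Functions of finite order reduce it to an open convex set in a
-- finite-dimensional space. The fibres of the parameter projection need not share a base point, so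
-- `exists_smooth_section_of_convex` chooses base points smoothly by a partition of unity, and
-- `exists_primitive_along_ker` integrates along the segments issuing from them.

universe u

/-! ### Poincaré lemma with parameters in finite dimension. -/

section Analysis

open Set Filter MeasureTheory Topology Interval

/-- Differentiation under the integral over `[0, 1]`. -/
theorem hasFDerivAt_integral_unitInterval {E G : Type*} [NormedAddCommGroup E] [NormedSpace ℝ E]
    [FiniteDimensional ℝ E] [NormedAddCommGroup G] [NormedSpace ℝ G]
    {A : Set E} (hA : IsOpen A) {Φ : E × ℝ → G}
    (hΦ : ∀ x ∈ A, ∀ t ∈ Icc (0 : ℝ) 1, ContDiffAt ℝ 1 Φ (x, t)) {x₀ : E} (hx₀ : x₀ ∈ A) :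
    HasFDerivAt (fun x => ∫ t in (0 : ℝ)..1, Φ (x, t))
      (∫ t in (0 : ℝ)..1, (fderiv ℝ Φ (x₀, t)).comp (ContinuousLinearMap.inl ℝ E ℝ)) x₀ := by
  have hproper : ProperSpace E := FiniteDimensional.proper ℝ E
  -- The derivative is bounded on the compact set ball × `[0, 1]`; this bound is the dominating
  -- constant.
  obtain ⟨r, hr, hrA⟩ := Metric.nhds_basis_closedBall.mem_iff.1 (hA.mem_nhds hx₀)
  have hcont (x : E) (hx : x ∈ A) : ContinuousOn (fun t => Φ (x, t)) (Icc 0 1) := fun t ht =>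
    ((hΦ x hx t ht).continuousAt.comp (f := fun t => (x, t))
      (by fun_prop)).continuousWithinAt
  have hcont' : ContinuousOn
      (fun z : E × ℝ => (fderiv ℝ Φ z).comp (ContinuousLinearMap.inl ℝ E ℝ))
      (Metric.closedBall x₀ r ×ˢ Icc (0 : ℝ) 1) := fun z hz => by
    have h := ((hΦ z.1 (hrA hz.1) z.2 hz.2).fderiv_right (m := 0) (by simp)).continuousAt
    exact (h.clm_comp continuousAt_const).continuousWithinAt
  obtain ⟨C, hC⟩ := ((isCompact_closedBall x₀ r).prod isCompact_Icc).exists_bound_of_continuousOn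
    hcont'
  have hsub : Ι (0 : ℝ) 1 ⊆ Icc 0 1 := by
    rw [uIoc_of_le zero_le_one]; exact Ioc_subset_Icc_self
  have hle : volume.restrict (Ι (0 : ℝ) 1) ≤ volume.restrict (Icc (0 : ℝ) 1) :=
    Measure.restrict_mono hsub le_rfl
  refine (intervalIntegral.hasFDerivAt_integral_of_dominated_of_fderiv_le
    (F' := fun x t => (fderiv ℝ Φ (x, t)).comp (ContinuousLinearMap.inl ℝ E ℝ))
    (bound := fun _ => C) (Metric.closedBall_mem_nhds x₀ hr) ?_ ?_ ?_ ?_ ?_ ?_)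
  · filter_upwards [hA.mem_nhds hx₀] with x hx 
      using ((hcont x hx).aestronglyMeasurable measurableSet_Icc).mono_measure hle
  · exact ContinuousOn.intervalIntegrable (by simpa using hcont x₀ hx₀)
  · exact ((hcont'.comp (f := fun t => (x₀, t)) (by fun_prop)
      fun t ht => ⟨Metric.mem_closedBall_self hr.le, ht⟩).aestronglyMeasurable
        measurableSet_Icc).mono_measure hle
  · exact ae_of_all _ fun t ht x hx => hC (x, t) ⟨hx, hsub ht⟩
  · exact intervalIntegrable_const
  · refine ae_of_all _ fun t ht x hx => ?_
    have h := ((hΦ x (hrA hx) t (hsub ht)).differentiableAt (by simp)).hasFDerivAt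
    exact h.comp x (hasFDerivAt_prodMk_left x t)

/-- The derivative of the integral is again such an integral, with values in `E →L[ℝ] G`. Hence the
induction on `n` is over all `G`, and `E` and `G` share a universe, which this change of target
preserves. -/
theorem contDiffOn_integral_unitInterval_nat {E : Type u} [NormedAddCommGroup E] [NormedSpace ℝ E]
    [FiniteDimensional ℝ E] {A : Set E} (hA : IsOpen A) (n : ℕ) :
    ∀ {G : Type u} [NormedAddCommGroup G] [NormedSpace ℝ G] {Φ : E × ℝ → G},
    (∀ x ∈ A, ∀ t ∈ Icc (0 : ℝ) 1, ContDiffAt ℝ ∞ Φ (x, t)) →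
    ContDiffOn ℝ n (fun x => ∫ t in (0 : ℝ)..1, Φ (x, t)) A := by
  induction n with
  | zero =>
    intro G _ _ Φ hΦ
    refine contDiffOn_zero.2 fun x hx => ?_
    exact (hasFDerivAt_integral_unitInterval hA
      (fun x hx t ht => (hΦ x hx t ht).of_le (by exact_mod_cast le_top))
        hx).continuousAt.continuousWithinAt
  | succ n ih =>
    intro G _ _ Φ hΦ
    have hd : ∀ x ∈ A, HasFDerivAt _ _ x := fun x hx => hasFDerivAt_integral_unitInterval hA
      (fun x hx t ht => (hΦ x hx t ht).of_le (by exact_mod_cast le_top)) hx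
    push_cast
    refine (contDiffOn_succ_iff_fderiv_of_isOpen hA).2
      ⟨fun x hx => (hd x hx).differentiableAt.differentiableWithinAt, by simp, ?_⟩
    refine (ih (Φ := fun z => (fderiv ℝ Φ z).comp (ContinuousLinearMap.inl ℝ E ℝ))
      fun x hx t ht => ?_).congr fun x hx => (hd x hx).fderiv
    exact ((hΦ x hx t ht).fderiv_right (m := ∞) (by simp)).clm_comp contDiffAt_const

/-- The integral over `[0, 1]` of a smooth function depends smoothly on parameters. -/
theorem contDiffOn_integral_unitInterval {E G : Type u} [NormedAddCommGroup E] [NormedSpace ℝ E]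
    [FiniteDimensional ℝ E] [NormedAddCommGroup G] [NormedSpace ℝ G]
    {A : Set E} (hA : IsOpen A) {Φ : E × ℝ → G}
    (hΦ : ∀ x ∈ A, ∀ t ∈ Icc (0 : ℝ) 1, ContDiffAt ℝ ∞ Φ (x, t)) :
    ContDiffOn ℝ ∞ (fun x => ∫ t in (0 : ℝ)..1, Φ (x, t)) A :=
  contDiffOn_infty.2 fun n => contDiffOn_integral_unitInterval_nat hA n hΦ

/-- Over a convex open set, a linear projection `P` has a smooth section with values in the set. -/
theorem exists_smooth_section_of_convex {E : Type*} [NormedAddCommGroup E] [NormedSpace ℝ E]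
    [FiniteDimensional ℝ E] {A : Set E} (hA : IsOpen A) (hc : Convex ℝ A) (P : E →L[ℝ] E)
    (hP : ∀ q, P (P q) = P q) :
    ∃ σ : E → E, ContDiffOn ℝ ∞ σ A ∧ ∀ q ∈ A, σ q ∈ A ∧ P (σ q) = P q ∧
      ∀ q', P q' = P q → σ q' = σ q := by
  -- `P w + (k - P k)` runs through the fibre of `P` over `P w` as `k` varies, so this is the set of
  -- `w` whose fibre meets `A`.
  have hW : IsOpen {w : E | ∃ k, P w + (k - P k) ∈ A} := by
    have : {w : E | ∃ k, P w + (k - P k) ∈ A} = ⋃ k, (fun w => P w + (k - P k)) ⁻¹' A := by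
      ext; simp
    rw [this]
    exact isOpen_iUnion fun k => hA.preimage (by fun_prop)
  let W : TopologicalSpace.Opens E := ⟨_, hW⟩
  have hproper : ProperSpace E := FiniteDimensional.proper ℝ E
  have hloc : LocallyCompactSpace W := W.isOpen.locallyCompactSpace
  have hsc : SecondCountableTopology E := secondCountable_of_proper
  -- Partition of unity: the admissible `k` form a convex set for each `w`, and by openness of `A`
  -- one admissible `k` stays admissible nearby.
  obtain ⟨g, hg⟩ := exists_contMDiffMap_forall_mem_convex_of_local_const (n := ⊤)
    (modelWithCornersSelf ℝ E)
    (t := fun w : W => {k : E | P w + (k - P k) ∈ A})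
    (fun w => by
      intro a ha b hb s t hs ht hst
      have := hc ha hb hs ht hst
      simp only [mem_ofPred_eq] at this ⊢
      convert this using 1
      simp only [map_add, map_smul]
      have h1 : P (w : E) = s • P (w : E) + t • P (w : E) := by rw [← add_smul, hst, one_smul]
      conv_lhs => rw [h1]
      module)
    (fun w => by
      obtain ⟨k, hk⟩ := w.2
      refine ⟨k, ?_⟩
      have : Continuous fun w : W => P (w : E) + (k - P k) := by fun_prop
      exact this.continuousAt.preimage_mem_nhds (hA.mem_nhds hk))
  classical
  let s : E → E := fun w => if h : w ∈ W then g ⟨w, h⟩ else 0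
  have hsW : ∀ w : W, s w = g w := fun w => by simp [s]
  have hs : ContDiffOn ℝ ∞ s W := fun w hw => by
    have h := (g.contMDiff.contMDiffAt (x := (⟨w, hw⟩ : W)))
    have h2 : (fun x : W => s x) = g := funext hsW
    rw [← h2] at h
    exact (contMDiffAt_iff_contDiffAt.1 (contMDiffAt_subtype_iff.1 h)).contDiffWithinAt
  -- The witness is `k = q`, since `P (P q) + (q - P q) = q`.
  have hmem : ∀ q ∈ A, P q ∈ W := fun q hq => ⟨q, by simpa [hP] using hq⟩
  have hsP : ContDiffOn ℝ ∞ (fun q => s (P q)) A := hs.comp P.contDiff.contDiffOn hmem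
  -- The section depends on `q` only through `P q`, hence is constant on fibres.
  refine ⟨fun q => P q + (s (P q) - P (s (P q))), ?_, fun q hq => ⟨?_, ?_, ?_⟩⟩
  · exact P.contDiff.contDiffOn.add (hsP.sub (P.contDiff.comp_contDiffOn hsP))
  · have := hg ⟨P q, hmem q hq⟩
    rw [← hsW] at this
    simpa [hP] using this
  · simp [hP]
  · intro q' h
    simp only [h]

theorem hasDerivAt_add_smul {E : Type*} [NormedAddCommGroup E] [NormedSpace ℝ E] (a v : E)
    {t : ℝ} : HasDerivAt (fun s : ℝ => a + s • v) v t := by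
  have h := ((hasDerivAt_id t).smul_const v).const_add a
  rw [one_smul] at h
  exact h

/-- Derivative of the homotopy integrand in a direction `v` with the base point `a` held fixed. -/
theorem hasDerivAt_radial_left {E : Type*} [NormedAddCommGroup E] [NormedSpace ℝ E]
    {Z : E → E →L[ℝ] ℝ} {Z' : E →L[ℝ] E →L[ℝ] ℝ} {a w : E} {t : ℝ}
    (hZ : HasFDerivAt Z Z' (a + t • w)) (v : E) :
    HasDerivAt (fun s : ℝ => Z (a + t • (w + s • v)) (w + s • v))
      (t * Z' v w + Z (a + t • w) v) 0 := by
  have h3 : HasDerivAt (fun s : ℝ => w + s • v) v 0 := hasDerivAt_add_smul w v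
  have hZ0 : HasFDerivAt Z Z' (a + t • (w + (0 : ℝ) • v)) := by
    rwa [zero_smul, add_zero]
  have h4 := hZ0.comp_hasDerivAt (0 : ℝ) ((h3.const_smul t).const_add a)
  refine (h4.clm_apply h3).congr_deriv ?_
  rw [Function.comp_apply, Pi.smul_apply, zero_smul, add_zero, map_smul,
    _root_.smul_apply, smul_eq_mul]

/-- When `Z' v w = Z' w v`, this `t`-derivative agrees with the derivative in
`hasDerivAt_radial_left`, so the differentiated integrand has an explicit antiderivative. -/
theorem hasDerivAt_radial_right {E : Type*} [NormedAddCommGroup E] [NormedSpace ℝ E]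
    {Z : E → E →L[ℝ] ℝ} {Z' : E →L[ℝ] E →L[ℝ] ℝ} {a w : E} {t : ℝ}
    (hZ : HasFDerivAt Z Z' (a + t • w)) (v : E) :
    HasDerivAt (fun t : ℝ => t * Z (a + t • w) v) (t * Z' w v + Z (a + t • w) v) t := by
  have h1 : HasDerivAt (fun t : ℝ => Z (a + t • w)) (Z' w) t :=
    hZ.comp_hasDerivAt t (hasDerivAt_add_smul a w)
  have h2 : HasDerivAt (fun t : ℝ => Z (a + t • w) v) (Z' w v) t :=
    ((ContinuousLinearMap.apply ℝ ℝ v).hasFDerivAt).comp_hasDerivAt t h1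
  have h3 : HasDerivAt (fun t : ℝ => t * Z (a + t • w) v)
      (1 * Z (a + t • w) v + t * Z' w v) t := (hasDerivAt_id' t).mul h2
  rwa [one_mul, add_comm] at h3

/-- The Poincaré lemma for `1`-forms with parameters: a smooth `1`-form on a convex open set which
is closed along the fibres of a linear projection `P` is exact along these fibres, with a smooth
primitive. -/
theorem exists_primitive_along_ker {E : Type} [NormedAddCommGroup E] [NormedSpace ℝ E]
    [FiniteDimensional ℝ E] {A : Set E} (hA : IsOpen A) (hc : Convex ℝ A) (P : E →L[ℝ] E)
    (hP : ∀ q, P (P q) = P q) {Z : E → E →L[ℝ] ℝ} (hZ : ContDiffOn ℝ ∞ Z A)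
    (hclosed : ∀ q ∈ A, ∀ v w, P v = 0 → P w = 0 → fderiv ℝ Z q v w = fderiv ℝ Z q w v) :
    ∃ h : E → ℝ, ContDiffOn ℝ ∞ h A ∧ ∀ q ∈ A, ∀ v, P v = 0 → fderiv ℝ h q v = Z q v := by
  obtain ⟨σ, hσ, hσA⟩ := exists_smooth_section_of_convex hA hc P hP
  have hσ' : ∀ q ∈ A, ContDiffAt ℝ ∞ σ q := fun q hq => (hσ q hq).contDiffAt (hA.mem_nhds hq)
  have hZ' : ∀ q ∈ A, ContDiffAt ℝ ∞ Z q := fun q hq => (hZ q hq).contDiffAt (hA.mem_nhds hq)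
  have hγ : ∀ q ∈ A, ∀ t ∈ Icc (0 : ℝ) 1, σ q + t • (q - σ q) ∈ A := fun q hq t ht =>
    hc.add_smul_sub_mem (hσA q hq).1 hq ht
  -- The primitive is the line integral of `Z` along the segment from `σ q` to `q`, which stays in
  -- `A` by convexity.
  set Φ : E × ℝ → ℝ := fun z => Z (σ z.1 + z.2 • (z.1 - σ z.1)) (z.1 - σ z.1) with hΦdef
  have hΦ : ∀ q ∈ A, ∀ t ∈ Icc (0 : ℝ) 1, ContDiffAt ℝ ∞ Φ (q, t) := fun q hq t ht => by
    have h1 : ContDiffAt ℝ ∞ (fun z : E × ℝ => σ z.1) (q, t) :=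
      (hσ' q hq).comp (q, t) contDiffAt_fst
    have h2 : ContDiffAt ℝ ∞ (fun z : E × ℝ => z.1 - σ z.1) (q, t) := contDiffAt_fst.sub h1
    have h3 : ContDiffAt ℝ ∞ (fun z : E × ℝ => σ z.1 + z.2 • (z.1 - σ z.1)) (q, t) :=
      h1.add (contDiffAt_snd.smul h2)
    exact ((hZ' _ (hγ q hq t ht)).comp (q, t) h3).clm_apply h2
  refine ⟨fun q => ∫ t in (0 : ℝ)..1, Φ (q, t), contDiffOn_integral_unitInterval hA hΦ,
    fun q hq v hv => ?_⟩
  have hd := hasFDerivAt_integral_unitInterval hA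
    (fun x hx t ht => (hΦ x hx t ht).of_le (by exact_mod_cast le_top)) hq
  have hcont : ContinuousOn
      (fun t : ℝ => (fderiv ℝ Φ (q, t)).comp (ContinuousLinearMap.inl ℝ E ℝ)) (Icc 0 1) :=
    fun t ht => by
      have h := ((hΦ q hq t ht).fderiv_right (m := 0) (by simp)).continuousAt
      have h' : ContinuousAt (fun t : ℝ => fderiv ℝ Φ (q, t)) t :=
        ContinuousAt.comp (f := fun t : ℝ => (q, t)) h (by fun_prop)
      exact (h'.clm_comp continuousAt_const).continuousWithinAt
  have hu : uIcc (0 : ℝ) 1 = Icc 0 1 := uIcc_of_le zero_le_one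
  rw [hd.fderiv, ContinuousLinearMap.intervalIntegral_apply
    (ContinuousOn.intervalIntegrable (by rwa [hu]))]
  set w := q - σ q with hw
  have hPw : P w = 0 := by rw [hw, map_sub, (hσA q hq).2.1, sub_self]
  have hZd : ∀ t ∈ Icc (0 : ℝ) 1,
      HasFDerivAt Z (fderiv ℝ Z (σ q + t • w)) (σ q + t • w) := fun t ht =>
    ((hZ' _ (hγ q hq t ht)).differentiableAt (by simp)).hasFDerivAt
  have key : ∀ t ∈ Icc (0 : ℝ) 1,
      (fderiv ℝ Φ (q, t)).comp (ContinuousLinearMap.inl ℝ E ℝ) v =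
        t * fderiv ℝ Z (σ q + t • w) w v + Z (σ q + t • w) v := fun t ht => by
    have hl : HasDerivAt (fun s : ℝ => (q + s • v, t)) (v, 0) 0 :=
      (hasDerivAt_add_smul q v).prodMk (hasDerivAt_const _ _)
    have h0 : HasFDerivAt Φ (fderiv ℝ Φ (q, t)) (q + (0 : ℝ) • v, t) := by
      rw [zero_smul, add_zero]
      exact ((hΦ q hq t ht).differentiableAt (by simp)).hasFDerivAt
    have h1 := h0.comp_hasDerivAt (0 : ℝ) hl
    have h2 : (Φ ∘ fun s : ℝ => (q + s • v, t)) =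
        fun s => Z (σ q + t • (w + s • v)) (w + s • v) := by
      funext s
      -- Moving within a fibre does not move the base point, so no derivative of `σ` appears.
      have : σ (q + s • v) = σ q := (hσA q hq).2.2 _ (by rw [map_add, map_smul, hv]; simp)
      have h3 : q + s • v - σ q = w + s • v := by rw [hw]; abel
      simp only [hΦdef, Function.comp_apply, this, h3]
    rw [h2] at h1
    have h7 : fderiv ℝ Z (σ q + t • w) v w = fderiv ℝ Z (σ q + t • w) w v :=
      hclosed _ (hγ q hq t ht) v w hv hPw
    rw [← h7]
    exact h1.unique (hasDerivAt_radial_left (hZd t ht) v)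
  have hI : ∀ t ∈ uIcc (0 : ℝ) 1, HasDerivAt (fun t : ℝ => t * Z (σ q + t • w) v)
      ((fderiv ℝ Φ (q, t)).comp (ContinuousLinearMap.inl ℝ E ℝ) v) t := fun t ht => by
    rw [hu] at ht
    rw [key t ht]
    exact hasDerivAt_radial_right (hZd t ht) v
  -- The antiderivative `t * Z (σ q + t • w) v` vanishes at `t = 0` and equals `Z q v` at `t = 1`.
  rw [intervalIntegral.integral_eq_sub_of_hasDerivAt hI
    (ContinuousOn.intervalIntegrable (by rw [hu]; exact hcont.clm_apply continuousOn_const))]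
  simp [hw]

end Analysis

/-! ### Functions of finite order on the jet space. -/

namespace FGordon

open Set Filter Topology

variable {m : ℕ}

/-- The coordinates of the first jet space. -/
def firstCoords (m : ℕ) : Finset (Coord m) :=
  Finset.univ.image Sum.inl ∪ (Finset.univ.image fun α => Sum.inr (Fib.u α)) ∪
    (Finset.univ.image fun α => Sum.inr (Fib.ux α 0)) ∪
    (Finset.univ.image fun α => Sum.inr (Fib.uy α 0))

/-- The restriction of a jet to the coordinates in `t`. -/
def res (t : Finset (Coord m)) (p : Jet m) : t → ℝ := fun c => p c

/-- The jet with given coordinates in `t`, all others being zero. -/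
def ext (t : Finset (Coord m)) (q : t → ℝ) : Jet m := fun c => if h : c ∈ t then q ⟨c, h⟩ else 0

/-- The jets over `V` whose coordinates outside `t` vanish. -/
def slice (t : Finset (Coord m)) (V : Set (FirstJet m)) : Set (t → ℝ) := ext t ⁻¹' jetsOver V

/-- Over `V`, the function `F` is a smooth function of the coordinates in `t`. -/
structure SmoothWith (t : Finset (Coord m)) (V : Set (FirstJet m)) (F : Jet m → ℝ) : Prop where
  sub : firstCoords m ⊆ t
  smooth : ContDiffOn ℝ ∞ (fun q => F (ext t q)) (slice t V)
  eq : ∀ p ∈ jetsOver V, F p = F (ext t (res t p))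

theorem contDiff_ext (t : Finset (Coord m)) (c : Coord m) :
    ContDiff ℝ ∞ fun q : t → ℝ => ext t q c := by
  unfold ext
  split_ifs with h
  · exact contDiff_apply ℝ ℝ _
  · exact contDiff_const

theorem contDiff_toFirstJet_ext (t : Finset (Coord m)) :
    ContDiff ℝ ∞ fun q : t → ℝ => toFirstJet (ext t q) := by
  unfold toFirstJet
  refine (contDiff_ext t _).prodMk ((contDiff_ext t _).prodMk (ContDiff.prodMk ?_
    (ContDiff.prodMk ?_ ?_)))
  all_goals exact contDiff_pi.2 fun α => contDiff_ext t _

theorem isOpen_slice (t : Finset (Coord m)) {V : Set (FirstJet m)} (hV : IsOpen V) :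
    IsOpen (slice t V) :=
  hV.preimage (contDiff_toFirstJet_ext t).continuous

theorem toFirstJet_congr {p p' : Jet m} (h : ∀ c ∈ firstCoords m, p c = p' c) :
    toFirstJet p = toFirstJet p' := by
  have h' : ∀ c, c ∈ firstCoords m → p c = p' c := h
  unfold toFirstJet
  rw [h' (Sum.inl 0) (by simp [firstCoords]), h' (Sum.inl 1) (by simp [firstCoords])]
  have h1 : (fun α => p (Sum.inr (Fib.u α))) = fun α => p' (Sum.inr (Fib.u α)) :=
    funext fun α => h' _ (by simp [firstCoords])
  have h2 : (fun α => p (Sum.inr (Fib.ux α 0))) = fun α => p' (Sum.inr (Fib.ux α 0)) :=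
    funext fun α => h' _ (by simp [firstCoords])
  have h3 : (fun α => p (Sum.inr (Fib.uy α 0))) = fun α => p' (Sum.inr (Fib.uy α 0)) :=
    funext fun α => h' _ (by simp [firstCoords])
  rw [h1, h2, h3]

theorem ext_res_apply {t : Finset (Coord m)} {c : Coord m} (hc : c ∈ t) (p : Jet m) :
    ext t (res t p) c = p c := by
  simp [ext, res, hc]

theorem res_ext (t : Finset (Coord m)) (q : t → ℝ) : res t (ext t q) = q := by
  funext c; simp [ext, res]

theorem toFirstJet_ext_res {t : Finset (Coord m)} (ht : firstCoords m ⊆ t) (p : Jet m) :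
    toFirstJet (ext t (res t p)) = toFirstJet p :=
  toFirstJet_congr fun _ hc => ext_res_apply (ht hc) p

theorem ext_res_mem {t : Finset (Coord m)} (ht : firstCoords m ⊆ t) {V : Set (FirstJet m)}
    {p : Jet m} (hp : p ∈ jetsOver V) : ext t (res t p) ∈ jetsOver V := by
  rw [jetsOver, mem_ofPred_eq, toFirstJet_ext_res ht]; exact hp

theorem res_mem_slice {t : Finset (Coord m)} (ht : firstCoords m ⊆ t) {V : Set (FirstJet m)}
    {p : Jet m} (hp : p ∈ jetsOver V) : res t p ∈ slice t V := ext_res_mem ht hp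

theorem convex_slice (t : Finset (Coord m)) {V : Set (FirstJet m)} (hV : Convex ℝ V) :
    Convex ℝ (slice t V) := by
  intro q hq q' hq' a b ha hb hab
  have h := hV hq hq' ha hb hab
  have he : ∀ c, ext t (a • q + b • q') c = a * ext t q c + b * ext t q' c := by
    intro c; unfold ext; split_ifs <;> simp
  have : toFirstJet (ext t (a • q + b • q')) =
      a • toFirstJet (ext t q) + b • toFirstJet (ext t q') := by
    simp only [toFirstJet, he, Prod.smul_mk, Prod.mk_add_mk, smul_eq_mul]
    rfl
  show toFirstJet _ ∈ V
  rw [this]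
  exact h

theorem continuous_update_jet (p : Jet m) (c : Coord m) :
    Continuous fun s : ℝ => toFirstJet (Function.update p c s) := by
  have h : ∀ d, Continuous fun s : ℝ => Function.update p c s d := fun d =>
    by
    by_cases hd : d = c
    · subst hd; simpa using continuous_id'
    · simpa [hd] using continuous_const
  unfold toFirstJet
  fun_prop

/-- This makes partial derivatives over `V` depend only on values over `V`. -/
theorem eventually_update_mem {V : Set (FirstJet m)} (hV : IsOpen V) {p : Jet m}
    (hp : p ∈ jetsOver V) (c : Coord m) :
    ∀ᶠ s in 𝓝 (p c), Function.update p c s ∈ jetsOver V :=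
  (continuous_update_jet p c).continuousAt.preimage_mem_nhds
    (hV.mem_nhds (by rw [Function.update_eq_self]; exact hp))

theorem SmoothWith.mono {t : Finset (Coord m)} {V W : Set (FirstJet m)} {F : Jet m → ℝ}
    (h : SmoothWith t V F) (hWV : W ⊆ V) : SmoothWith t W F :=
  ⟨h.sub, h.smooth.mono fun _ hq => hWV hq, fun p hp => h.eq p (hWV hp)⟩

/-- The coordinate set may be enlarged freely, so several functions can share one. It must contain
the first-jet coordinates, which decide membership in `jetsOver V`. -/
theorem SmoothOver.exists_smoothWith {V : Set (FirstJet m)} {F : Jet m → ℝ}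
    (h : SmoothOver V F) : ∃ s, ∀ t, s ⊆ t → SmoothWith t V F := by
  obtain ⟨s, g, hg, hF⟩ := h
  refine ⟨s ∪ firstCoords m, fun t ht => ?_⟩
  have hs : s ⊆ t := Finset.subset_union_left.trans ht
  have hf : firstCoords m ⊆ t := Finset.subset_union_right.trans ht
  refine ⟨hf, ?_, fun p hp => ?_⟩
  · have hr : ContDiff ℝ ∞ fun q : t → ℝ => res s (ext t q) :=
      contDiff_pi.2 fun c => contDiff_ext t c
    refine (hg.comp hr.contDiffOn fun q hq => ⟨ext t q, hq, rfl⟩).congr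
      fun q hq => hF _ hq
  · rw [hF p hp, hF _ (ext_res_mem hf hp)]
    congr 1
    funext c
    exact (ext_res_apply (hs c.2) p).symm

theorem SmoothWith.smoothOver {t : Finset (Coord m)} {V : Set (FirstJet m)} {F : Jet m → ℝ}
    (h : SmoothWith t V F) : SmoothOver V F := by
  refine ⟨t, fun q => F (ext t q), h.smooth.mono ?_, h.eq⟩
  rintro _ ⟨p, hp, rfl⟩
  exact res_mem_slice h.sub hp

theorem SmoothOver.mono {V W : Set (FirstJet m)} {F : Jet m → ℝ}
    (h : SmoothOver V F) (hWV : W ⊆ V) : SmoothOver W F := by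
  obtain ⟨s, hs⟩ := h.exists_smoothWith
  exact ((hs s subset_rfl).mono hWV).smoothOver

theorem SmoothOver.congr {V : Set (FirstJet m)} {F G : Jet m → ℝ}
    (h : SmoothOver V F) (hFG : ∀ p ∈ jetsOver V, G p = F p) : SmoothOver V G := by
  obtain ⟨s, g, hg, hF⟩ := h
  exact ⟨s, g, hg, fun p hp => (hFG p hp).trans (hF p hp)⟩

theorem SmoothOver.exists_common {V : Set (FirstJet m)} {F G : Jet m → ℝ}
    (hF : SmoothOver V F) (hG : SmoothOver V G) : ∃ t, SmoothWith t V F ∧ SmoothWith t V G := by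
  obtain ⟨s, hs⟩ := hF.exists_smoothWith
  obtain ⟨s', hs'⟩ := hG.exists_smoothWith
  exact ⟨s ∪ s', hs _ Finset.subset_union_left, hs' _ Finset.subset_union_right⟩

theorem SmoothOver.add {V : Set (FirstJet m)} {F G : Jet m → ℝ}
    (hF : SmoothOver V F) (hG : SmoothOver V G) : SmoothOver V fun p => F p + G p := by
  obtain ⟨t, h, h'⟩ := hF.exists_common hG
  exact SmoothWith.smoothOver
    ⟨h.sub, h.smooth.add h'.smooth, fun p hp => by rw [h.eq p hp, h'.eq p hp]⟩

theorem SmoothOver.mul {V : Set (FirstJet m)} {F G : Jet m → ℝ}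
    (hF : SmoothOver V F) (hG : SmoothOver V G) : SmoothOver V fun p => F p * G p := by
  obtain ⟨t, h, h'⟩ := hF.exists_common hG
  exact SmoothWith.smoothOver
    ⟨h.sub, h.smooth.mul h'.smooth, fun p hp => by rw [h.eq p hp, h'.eq p hp]⟩

theorem smoothOver_const (V : Set (FirstJet m)) (a : ℝ) : SmoothOver V fun _ => a :=
  SmoothWith.smoothOver ⟨subset_rfl, contDiffOn_const, fun _ _ => rfl⟩

theorem SmoothOver.sub {V : Set (FirstJet m)} {F G : Jet m → ℝ}
    (hF : SmoothOver V F) (hG : SmoothOver V G) : SmoothOver V fun p => F p - G p :=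
  (hF.add ((smoothOver_const V (-1)).mul hG)).congr fun p _ => by ring

theorem smoothOver_sum {ι : Type*} {V : Set (FirstJet m)} (s : Finset ι) {F : ι → Jet m → ℝ}
    (hF : ∀ i ∈ s, SmoothOver V (F i)) : SmoothOver V fun p => ∑ i ∈ s, F i p := by
  classical
  induction s using Finset.induction_on with
  | empty => simpa using smoothOver_const V 0
  | insert i s hi ih =>
    simp only [Finset.sum_insert hi]
    exact (hF i (by simp)).add (ih fun j hj => hF j (by simp [hj]))

theorem smoothOver_coord (V : Set (FirstJet m)) (c : Coord m) : SmoothOver V fun p => p c :=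
  SmoothWith.smoothOver (t := insert c (firstCoords m)) ⟨Finset.subset_insert _ _,
    (contDiff_ext _ c).contDiffOn, fun p _ => (ext_res_apply (by simp) p).symm⟩

theorem smoothOver_firstJet {V : Set (FirstJet m)} {g : FirstJet m → ℝ}
    (hg : ContDiffOn ℝ ∞ g V) : SmoothOver V fun p => g (toFirstJet p) :=
  SmoothWith.smoothOver (t := firstCoords m) ⟨subset_rfl,
    hg.comp (contDiff_toFirstJet_ext _).contDiffOn fun _ hq => hq,
    fun p _ => by rw [toFirstJet_ext_res subset_rfl]⟩

/-! ### Partial derivatives and derivatives along vector fields. -/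

theorem res_update_of_mem {t : Finset (Coord m)} {c : Coord m} (hc : c ∈ t) (p : Jet m) (s : ℝ) :
    res t (Function.update p c s) = Function.update (res t p) ⟨c, hc⟩ s := by
  funext d
  by_cases h : d = ⟨c, hc⟩
  · subst h; simp [res]
  · have : (d : Coord m) ≠ c := fun h' => h (Subtype.ext h')
    simp [res, h, this]

theorem res_update_of_notMem {t : Finset (Coord m)} {c : Coord m} (hc : c ∉ t) (p : Jet m)
    (s : ℝ) : res t (Function.update p c s) = res t p := by
  funext d
  have : (d : Coord m) ≠ c := fun h' => hc (h' ▸ d.2)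
  simp [res, this]

theorem SmoothWith.hasDerivAt {t : Finset (Coord m)} {V : Set (FirstJet m)} (hV : IsOpen V)
    {F : Jet m → ℝ} (h : SmoothWith t V F) {p : Jet m} (hp : p ∈ jetsOver V) {c : Coord m}
    (hc : c ∈ t) :
    HasDerivAt (fun s : ℝ => F (Function.update p c s))
      (fderiv ℝ (fun q => F (ext t q)) (res t p) (Pi.single ⟨c, hc⟩ 1)) (p c) := by
  have hd : HasFDerivAt (fun q => F (ext t q)) (fderiv ℝ (fun q => F (ext t q)) (res t p))
      (Function.update (res t p) ⟨c, hc⟩ (p c)) := by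
    have : Function.update (res t p) ⟨c, hc⟩ (p c) = res t p :=
      Function.update_eq_self (⟨c, hc⟩ : t) (res t p)
    rw [this]
    exact ((h.smooth.contDiffAt ((isOpen_slice t hV).mem_nhds
      (res_mem_slice h.sub hp))).differentiableAt (by simp)).hasFDerivAt
  refine (hd.comp_hasDerivAt (p c) (hasDerivAt_update (res t p) ⟨c, hc⟩ (p c))).congr_of_eventuallyEq
    ?_
  filter_upwards [eventually_update_mem hV hp c] with s hs
  rw [h.eq _ hs, res_update_of_mem hc]
  rfl

theorem SmoothWith.hasDerivAt_zero {t : Finset (Coord m)} {V : Set (FirstJet m)} (hV : IsOpen V)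
    {F : Jet m → ℝ} (h : SmoothWith t V F) {p : Jet m} (hp : p ∈ jetsOver V) {c : Coord m}
    (hc : c ∉ t) : HasDerivAt (fun s : ℝ => F (Function.update p c s)) 0 (p c) := by
  refine (hasDerivAt_const (p c) (F (ext t (res t p)))).congr_of_eventuallyEq ?_
  filter_upwards [eventually_update_mem hV hp c] with s hs
  rw [h.eq _ hs, res_update_of_notMem hc]

theorem SmoothWith.pd_eq {t : Finset (Coord m)} {V : Set (FirstJet m)} (hV : IsOpen V)
    {F : Jet m → ℝ} (h : SmoothWith t V F) {p : Jet m} (hp : p ∈ jetsOver V) {c : Coord m}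
    (hc : c ∈ t) :
    pd c F p = fderiv ℝ (fun q => F (ext t q)) (res t p) (Pi.single ⟨c, hc⟩ 1) :=
  (h.hasDerivAt hV hp hc).deriv

theorem SmoothWith.pd_eq_zero {t : Finset (Coord m)} {V : Set (FirstJet m)} (hV : IsOpen V)
    {F : Jet m → ℝ} (h : SmoothWith t V F) {p : Jet m} (hp : p ∈ jetsOver V) {c : Coord m}
    (hc : c ∉ t) : pd c F p = 0 :=
  (h.hasDerivAt_zero hV hp hc).deriv

theorem SmoothOver.differentiableAt {V : Set (FirstJet m)} (hV : IsOpen V)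
    {F : Jet m → ℝ} (h : SmoothOver V F) {p : Jet m} (hp : p ∈ jetsOver V) (c : Coord m) :
    DifferentiableAt ℝ (fun s : ℝ => F (Function.update p c s)) (p c) := by
  obtain ⟨t, ht⟩ := h.exists_smoothWith
  exact ((ht (insert c t) (Finset.subset_insert _ _)).hasDerivAt hV hp
    (Finset.mem_insert_self _ _)).differentiableAt

theorem pd_congr {V : Set (FirstJet m)} (hV : IsOpen V) {F G : Jet m → ℝ}
    (h : ∀ p ∈ jetsOver V, F p = G p) (c : Coord m) {p : Jet m} (hp : p ∈ jetsOver V) :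
    pd c F p = pd c G p := by
  refine EventuallyEq.deriv_eq ?_
  filter_upwards [eventually_update_mem hV hp c] with s hs using h _ hs

theorem pd_const (c : Coord m) (a : ℝ) (p : Jet m) : pd c (fun _ => a) p = 0 := by
  simp [pd]

theorem SmoothWith.pd {t : Finset (Coord m)} {V : Set (FirstJet m)} (hV : IsOpen V)
    {F : Jet m → ℝ} (h : SmoothWith t V F) (c : Coord m) : SmoothWith t V (pd c F) := by
  have hm : ∀ q ∈ slice t V, ext t q ∈ jetsOver V := fun q hq => hq
  by_cases hc : c ∈ t
  · refine ⟨h.sub, ?_, fun p hp => ?_⟩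
    · refine (((h.smooth.fderiv_of_isOpen (m := ∞) (isOpen_slice t hV) (by simp)).clm_apply
        (contDiffOn_const (c := Pi.single ⟨c, hc⟩ 1)))).congr fun q hq => ?_
      rw [h.pd_eq hV (hm q hq) hc, res_ext]
    · rw [h.pd_eq hV hp hc, h.pd_eq hV (ext_res_mem h.sub hp) hc, res_ext]
  · refine ⟨h.sub, ?_, fun p hp => ?_⟩
    · exact (contDiffOn_const (c := (0 : ℝ))).congr fun q hq => h.pd_eq_zero hV (hm q hq) hc
    · rw [h.pd_eq_zero hV hp hc, h.pd_eq_zero hV (ext_res_mem h.sub hp) hc]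

theorem SmoothOver.pd {V : Set (FirstJet m)} (hV : IsOpen V) {F : Jet m → ℝ}
    (h : SmoothOver V F) (c : Coord m) : SmoothOver V (pd c F) := by
  obtain ⟨t, ht⟩ := h.exists_smoothWith
  exact ((ht t subset_rfl).pd hV c).smoothOver

/-- Once `c` and `d` are among the coordinates of the slice, this is the symmetry of the second
Fréchet derivative there. -/
theorem pd_comm {V : Set (FirstJet m)} (hV : IsOpen V) {F : Jet m → ℝ}
    (h : SmoothOver V F) (c d : Coord m) {p : Jet m} (hp : p ∈ jetsOver V) :
    pd c (pd d F) p = pd d (pd c F) p := by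
  obtain ⟨t, ht⟩ := h.exists_smoothWith
  have h1 := ht (insert c (insert d t)) ((Finset.subset_insert _ _).trans (Finset.subset_insert _ _))
  have hc : c ∈ insert c (insert d t) := by simp
  have hd : d ∈ insert c (insert d t) := by simp
  generalize insert c (insert d t) = t' at h1 hc hd
  have hq := res_mem_slice h1.sub hp
  have hO := (isOpen_slice t' hV).mem_nhds hq
  have hs := h1.smooth.contDiffAt hO
  have key : ∀ (a b : Coord m) (ha : a ∈ t') (hb : b ∈ t'), FGordon.pd a (FGordon.pd b F) p =
      fderiv ℝ (fderiv ℝ fun q => F (ext t' q)) (res t' p) (Pi.single ⟨a, ha⟩ 1)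
        (Pi.single ⟨b, hb⟩ 1) := fun a b ha hb => by
    rw [(h1.pd hV b).pd_eq hV hp ha]
    have he : (fun q => FGordon.pd b F (ext t' q)) =ᶠ[𝓝 (res t' p)] fun q =>
        fderiv ℝ (fun q => F (ext t' q)) q (Pi.single ⟨b, hb⟩ 1) := by
      filter_upwards [hO] with q hq
      rw [h1.pd_eq hV (show ext t' q ∈ jetsOver V from hq) hb, res_ext]
    rw [he.fderiv_eq, fderiv_clm_apply ((hs.fderiv_right (m := ∞) (by simp)).differentiableAt (by simp)) (by fun_prop)]
    simp
  rw [key c d hc hd, key d c hd hc]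
  exact (hs.isSymmSndFDerivAt (by simpa using (WithTop.coe_le_coe.2 le_top : ((2 : ℕ∞) : ℕ∞ω) ≤ ∞))).eq _ _

theorem pd_add {V : Set (FirstJet m)} (hV : IsOpen V) {F G : Jet m → ℝ} (hF : SmoothOver V F)
    (hG : SmoothOver V G) (c : Coord m) {p : Jet m} (hp : p ∈ jetsOver V) :
    pd c (fun p => F p + G p) p = pd c F p + pd c G p :=
  deriv_fun_add (hF.differentiableAt hV hp c) (hG.differentiableAt hV hp c)

theorem pd_sub {V : Set (FirstJet m)} (hV : IsOpen V) {F G : Jet m → ℝ} (hF : SmoothOver V F)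
    (hG : SmoothOver V G) (c : Coord m) {p : Jet m} (hp : p ∈ jetsOver V) :
    pd c (fun p => F p - G p) p = pd c F p - pd c G p :=
  deriv_fun_sub (hF.differentiableAt hV hp c) (hG.differentiableAt hV hp c)

theorem pd_mul {V : Set (FirstJet m)} (hV : IsOpen V) {F G : Jet m → ℝ} (hF : SmoothOver V F)
    (hG : SmoothOver V G) (c : Coord m) {p : Jet m} (hp : p ∈ jetsOver V) :
    pd c (fun p => F p * G p) p = pd c F p * G p + F p * pd c G p := by
  have h := deriv_fun_mul (hF.differentiableAt hV hp c) (hG.differentiableAt hV hp c)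
  simp only [Function.update_eq_self] at h
  exact h

theorem pd_sum {ι : Type*} {V : Set (FirstJet m)} (hV : IsOpen V) (s : Finset ι)
    {F : ι → Jet m → ℝ} (hF : ∀ i ∈ s, SmoothOver V (F i)) (c : Coord m) {p : Jet m}
    (hp : p ∈ jetsOver V) : pd c (fun p => ∑ i ∈ s, F i p) p = ∑ i ∈ s, pd c (F i) p :=
  deriv_fun_sum fun i hi => (hF i hi).differentiableAt hV hp c

/-- Over `V`, only finitely many fibre derivatives of a smooth function are nonzero. -/
theorem SmoothOver.exists_fib {V : Set (FirstJet m)} (hV : IsOpen V) {F : Jet m → ℝ}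
    (h : SmoothOver V F) :
    ∃ s : Finset (Fib m), ∀ c ∉ s, ∀ p ∈ jetsOver V, FGordon.pd (Sum.inr c) F p = 0 := by
  obtain ⟨t, ht⟩ := h.exists_smoothWith
  exact ⟨t.preimage Sum.inr Sum.inr_injective.injOn, fun c hc p hp =>
    (ht t subset_rfl).pd_eq_zero hV hp fun h => hc (by simpa using h)⟩

theorem along_eq_sum (i : Fin 2) (v : Fib m → Jet m → ℝ) {F : Jet m → ℝ} {p : Jet m}
    {s : Finset (Fib m)} (hs : ∀ c ∉ s, pd (Sum.inr c) F p = 0) :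
    along i v F p = pd (Sum.inl i) F p + ∑ c ∈ s, v c p * pd (Sum.inr c) F p := by
  unfold along
  rw [finsum_eq_sum_of_support_subset]
  intro c hc
  by_contra h
  exact hc (by simp [hs c h])

theorem smoothOver_along {V : Set (FirstJet m)} (hV : IsOpen V) (i : Fin 2)
    {v : Fib m → Jet m → ℝ} (hv : ∀ c, SmoothOver V (v c)) {F : Jet m → ℝ}
    (h : SmoothOver V F) : SmoothOver V (along i v F) := by
  obtain ⟨s, hs⟩ := h.exists_fib hV
  exact ((h.pd hV _).add (smoothOver_sum s fun c _ => (hv c).mul (h.pd hV _))).congr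
    fun p hp => along_eq_sum i v fun c hc => hs c hc p hp

theorem along_congr {V : Set (FirstJet m)} (hV : IsOpen V) (i : Fin 2) (v : Fib m → Jet m → ℝ)
    {F G : Jet m → ℝ} (h : ∀ p ∈ jetsOver V, F p = G p) {p : Jet m} (hp : p ∈ jetsOver V) :
    along i v F p = along i v G p := by
  simp only [along, pd_congr hV h _ hp]

theorem along_add {V : Set (FirstJet m)} (hV : IsOpen V) (i : Fin 2) (v : Fib m → Jet m → ℝ)
    {F G : Jet m → ℝ} (hF : SmoothOver V F) (hG : SmoothOver V G) {p : Jet m}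
    (hp : p ∈ jetsOver V) :
    along i v (fun p => F p + G p) p = along i v F p + along i v G p := by
  obtain ⟨s, hs⟩ := hF.exists_fib hV
  obtain ⟨s', hs'⟩ := hG.exists_fib hV
  rw [along_eq_sum i v (F := F) (s := s ∪ s') fun c hc =>
      hs c (fun h => hc (Finset.mem_union_left _ h)) p hp,
    along_eq_sum i v (F := G) (s := s ∪ s') fun c hc =>
      hs' c (fun h => hc (Finset.mem_union_right _ h)) p hp,
    along_eq_sum i v (s := s ∪ s') fun c hc => by
      rw [pd_add hV hF hG _ hp, hs c (fun h => hc (Finset.mem_union_left _ h)) p hp,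
        hs' c (fun h => hc (Finset.mem_union_right _ h)) p hp, add_zero]]
  simp only [pd_add hV hF hG _ hp, mul_add, Finset.sum_add_distrib]
  ring

/-- The commutator of a fibre derivative and the derivative along a vector field. -/
theorem pd_along {V : Set (FirstJet m)} (hV : IsOpen V) (i : Fin 2)
    {v : Fib m → Jet m → ℝ} (hv : ∀ c, SmoothOver V (v c)) {F : Jet m → ℝ}
    (h : SmoothOver V F) (c : Coord m) {p : Jet m} (hp : p ∈ jetsOver V) :
    pd c (along i v F) p = along i v (pd c F) p +
      ∑ᶠ e : Fib m, pd c (v e) p * pd (Sum.inr e) F p := by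
  obtain ⟨s, hs⟩ := h.exists_fib hV
  have h0 : ∀ e ∉ s, pd (Sum.inr e) (pd c F) p = 0 := fun e he => by
    rw [pd_comm hV h _ _ hp, pd_congr hV (G := fun _ => 0) (fun q hq => hs e he q hq) c hp, pd_const]
  rw [pd_congr hV (fun p hp => along_eq_sum i v fun c hc => hs c hc p hp) c hp,
    along_eq_sum i v h0,
    finsum_eq_sum_of_support_subset (s := s) _ fun e he => by
      by_contra h; exact he (by simp [hs e h p hp]),
    pd_add hV (h.pd hV _) (smoothOver_sum s fun c _ => (hv c).mul (h.pd hV _)) c hp,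
    pd_sum hV s (fun c _ => (hv c).mul (h.pd hV _)) c hp, pd_comm hV h _ _ hp, add_assoc,
    ← Finset.sum_add_distrib]
  congr 1
  refine Finset.sum_congr rfl fun e _ => ?_
  rw [pd_mul hV (hv e) (h.pd hV _) c hp, pd_comm hV h _ _ hp, add_comm]

/-! ### Smoothness of the components of the total derivatives. -/

section Equation

variable {V : Set (FirstJet m)} {f : Fin m → FirstJet m → ℝ}

theorem smoothOver_xCompAux (hf : ∀ α, ContDiffOn ℝ ∞ (f α) V) :
    ∀ c, SmoothOver V (xCompAux f c)
  | Fib.u _ => smoothOver_coord V _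
  | Fib.ux _ _ => smoothOver_coord V _
  | Fib.uy α 0 => smoothOver_firstJet (hf α)
  | Fib.uy _ (_ + 1) => smoothOver_const V 0

theorem smoothOver_yCompAux (hf : ∀ α, ContDiffOn ℝ ∞ (f α) V) :
    ∀ c, SmoothOver V (yCompAux f c)
  | Fib.u _ => smoothOver_coord V _
  | Fib.uy _ _ => smoothOver_coord V _
  | Fib.ux α 0 => smoothOver_firstJet (hf α)
  | Fib.ux _ (_ + 1) => smoothOver_const V 0

theorem smoothOver_xIter (hV : IsOpen V) (hf : ∀ α, ContDiffOn ℝ ∞ (f α) V) (α : Fin m) :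
    ∀ k, SmoothOver V (xIter f α k)
  | 0 => smoothOver_firstJet (hf α)
  | k + 1 => smoothOver_along hV 0 (smoothOver_xCompAux hf) (smoothOver_xIter hV hf α k)

theorem smoothOver_yIter (hV : IsOpen V) (hf : ∀ α, ContDiffOn ℝ ∞ (f α) V) (α : Fin m) :
    ∀ k, SmoothOver V (yIter f α k)
  | 0 => smoothOver_firstJet (hf α)
  | k + 1 => smoothOver_along hV 1 (smoothOver_yCompAux hf) (smoothOver_yIter hV hf α k)

theorem smoothOver_comp (hV : IsOpen V) (hf : ∀ α, ContDiffOn ℝ ∞ (f α) V) :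
    ∀ i c, SmoothOver V (comp f i c)
  | 0, Fib.u _ => smoothOver_coord V _
  | 0, Fib.ux _ _ => smoothOver_coord V _
  | 0, Fib.uy α k => smoothOver_yIter hV hf α k
  | 1, Fib.u _ => smoothOver_coord V _
  | 1, Fib.uy _ _ => smoothOver_coord V _
  | 1, Fib.ux α k => smoothOver_xIter hV hf α k

end Equation

end FGordon

/-! ### Poincaré lemma on the jet space. -/

namespace FGordon

open Set Filter Topology

variable {m : ℕ}

/-- The Poincaré lemma for `1`-forms on the jets over a convex set, along the coordinates in `K`;
the remaining coordinates are parameters. -/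
theorem exists_primitive {V : Set (FirstJet m)} (hV : IsOpen V) (hc : Convex ℝ V)
    (K : Set (Coord m)) {ζ : Coord m → Jet m → ℝ} (hζ : ∀ c, SmoothOver V (ζ c))
    {t₀ : Finset (Coord m)} (hfin : ∀ c ∉ t₀, ∀ p ∈ jetsOver V, ζ c p = 0)
    (hclosed : ∀ c ∈ K, ∀ d ∈ K, ∀ p ∈ jetsOver V, pd c (ζ d) p = pd d (ζ c) p) :
    ∃ G, SmoothOver V G ∧ ∀ c ∈ K, ∀ p ∈ jetsOver V, pd c G p = ζ c p := by
  classical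
  choose s hs using fun c => (hζ c).exists_smoothWith
  -- Only the finitely many components in `t₀` can be nonzero, so one finite set of coordinates
  -- serves the whole family.
  obtain ⟨t, hft, ht, hst⟩ : ∃ t : Finset (Coord m), firstCoords m ⊆ t ∧ t₀ ⊆ t ∧
      ∀ c, SmoothWith t V (ζ c) := by
    let t := firstCoords m ∪ (t₀ ∪ t₀.biUnion s)
    have hft : firstCoords m ⊆ t := Finset.subset_union_left
    refine ⟨t, hft, Finset.subset_union_left.trans Finset.subset_union_right, fun c => ?_⟩
    by_cases hc : c ∈ t₀
    · exact hs c _ ((Finset.subset_biUnion_of_mem s hc).trans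
        (Finset.subset_union_right.trans Finset.subset_union_right))
    · exact ⟨hft, (contDiffOn_const (c := (0 : ℝ))).congr fun q hq => hfin c hc _ hq,
        fun p hp => by rw [hfin c hc p hp, hfin c hc _ (ext_res_mem hft hp)]⟩
  let π : t → (t → ℝ) →L[ℝ] ℝ := fun c => ContinuousLinearMap.proj c
  let Z : (t → ℝ) → (t → ℝ) →L[ℝ] ℝ := fun q => ∑ c : t, ζ c (ext t q) • π c
  have hZ : ContDiffOn ℝ ∞ Z (slice t V) :=
    ContDiffOn.sum fun c _ => (hst c).smooth.smul contDiffOn_const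
  -- `P` forgets the coordinates in `K` and keeps the parameters; its kernel consists of the
  -- directions in `K`.
  let P : (t → ℝ) →L[ℝ] (t → ℝ) := ContinuousLinearMap.pi fun c =>
    if (c : Coord m) ∈ K then 0 else ContinuousLinearMap.proj c
  have hP : ∀ q c, P q c = if (c : Coord m) ∈ K then 0 else q c := fun q c => by
    simp only [P, ContinuousLinearMap.pi_apply]; split_ifs <;> rfl
  have hsingle : ∀ (v : t → ℝ), v = ∑ c, v c • Pi.single c (1 : ℝ) := fun v => by
    funext d; simp [Finset.sum_apply, Pi.single_apply]
  have hfd : ∀ q ∈ slice t V, ∀ v w, fderiv ℝ Z q v w =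
      ∑ c, ∑ d, v d * w c * pd d (ζ c) (ext t q) := fun q hq v w => by
    have hd : ∀ c : Coord m, HasFDerivAt (fun q => ζ c (ext t q))
        (fderiv ℝ (fun q => ζ c (ext t q)) q) q := fun c =>
      (((hst c).smooth.contDiffAt ((isOpen_slice t hV).mem_nhds hq)).differentiableAt
        (by simp)).hasFDerivAt
    have h1 : HasFDerivAt Z (∑ c : t, (fderiv ℝ (fun q => ζ c (ext t q)) q).smulRight (π c)) q :=
      HasFDerivAt.fun_sum fun c _ => (hd c).smul_const (π c)
    rw [h1.fderiv]
    simp only [π, sum_apply, ContinuousLinearMap.smulRight_apply, smul_apply,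
      ContinuousLinearMap.proj_apply, smul_eq_mul]
    refine Finset.sum_congr rfl fun c _ => ?_
    conv_lhs => rw [hsingle v, map_sum, Finset.sum_mul]
    refine Finset.sum_congr rfl fun d _ => ?_
    rw [(hst c).pd_eq hV (show ext t q ∈ jetsOver V from hq) d.2, res_ext, map_smul, smul_eq_mul]
    ring
  have hker : ∀ v, P v = 0 → ∀ c : t, (c : Coord m) ∉ K → v c = 0 := fun v hv c hc => by
    have := congrFun hv c
    simpa [hP, hc] using this
  obtain ⟨h, hh, hhd⟩ := exists_primitive_along_ker (isOpen_slice t hV) (convex_slice t hc) P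
    (fun q => by funext c; simp only [hP]; split_ifs <;> rfl) hZ
    (fun q hq v w hv hw => by
      rw [hfd q hq, hfd q hq, Finset.sum_comm]
      refine Finset.sum_congr rfl fun d _ => Finset.sum_congr rfl fun c _ => ?_
      by_cases hdK : (d : Coord m) ∈ K
      · by_cases hcK : (c : Coord m) ∈ K
        · rw [hclosed d hdK c hcK _ hq]; ring
        · rw [hker w hw c hcK]; ring
      · rw [hker v hv d hdK]; ring)
  have hG : SmoothWith t V fun p => h (res t p) :=
    ⟨hft, by simpa only [res_ext] using hh, fun p _ => by rw [res_ext]⟩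
  refine ⟨_, hG.smoothOver, fun c hcK p hp => ?_⟩
  by_cases hct : c ∈ t
  · rw [hG.pd_eq hV hp hct]
    simp only [res_ext]
    rw [hhd _ (res_mem_slice hft hp) _ (by
      funext d
      rw [hP]
      split_ifs with hd
      · rfl
      · have : d ≠ ⟨c, hct⟩ := fun h' => hd (by rw [h']; exact hcK)
        simp [this])]
    rw [(hst c).eq p hp]
    simp only [Z, π, sum_apply, smul_apply, ContinuousLinearMap.proj_apply,
      smul_eq_mul]
    rw [Finset.sum_eq_single ⟨c, hct⟩ (fun d _ hd => by simp [hd]) (by simp)]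
    simp
  -- For a coordinate outside `t` both sides vanish.
  · rw [hG.pd_eq_zero hV hp hct, hfin c (fun h' => hct (ht h')) p hp]

end FGordon

/-! ### Forms of low type and the two primitives. -/

namespace FGordon

open Set Filter Topology

variable {m : ℕ}

theorem lieD_one_one (f : Fin m → FirstJet m → ℝ) (i j : Fin 2) (η : BiForm m 1 1) (c : Fib m)
    (p : Jet m) : lieD f i η ![j] ![c] p = totalD f i (η ![j] ![c]) p +
      ∑ᶠ e : Fib m, pd (Sum.inr c) (comp f i e) p * η ![j] ![e] p := by
  have h : ∀ e, Function.update ![c] 0 e = ![e] := fun e => by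
    funext k; rw [Subsingleton.elim k 0]; simp
  simp [lieD, h]

theorem dH_one_one (f : Fin m → FirstJet m → ℝ) (η : BiForm m 1 1) (c : Fib m)
    (p : Jet m) : dH f η ![0, 1] ![c] p =
      lieD f 0 η ![1] ![c] p - lieD f 1 η ![0] ![c] p := by
  have h0 : (![0, 1] : Fin 2 → Fin 2) ∘ Fin.succ = ![1] := by
    funext k; rw [Subsingleton.elim k 0]; rfl
  have h1 : (![0, 1] : Fin 2 → Fin 2) ∘ Fin.succAbove 1 = ![0] := by
    funext k; rw [Subsingleton.elim k 0]; rfl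
  simp [dH, Fin.sum_univ_two, h0, h1, sub_eq_add_neg]

theorem dV_one_one (η : BiForm m 1 1) (i : Fin 2) (c d : Fib m) (p : Jet m) :
    dV η ![i] ![c, d] p =
      pd (Sum.inr d) (η ![i] ![c]) p - pd (Sum.inr c) (η ![i] ![d]) p := by
  have h0 : ![c, d] ∘ Fin.succ = ![d] := by
    funext k; rw [Subsingleton.elim k 0]; rfl
  have h1 : ![c, d] ∘ Fin.succAbove 1 = ![c] := by
    funext k; rw [Subsingleton.elim k 0]; rfl
  simp [dV, Fin.sum_univ_two, h0, h1, sub_eq_add_neg, add_comm]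

theorem lagrangianForm_apply (L : FirstJet m → ℝ) (C : Fin 0 → Fib m) (a b : Fin 2) (p : Jet m) :
    lagrangianForm L ![a, b] C p =
      L (toFirstJet p) * ((if a = 0 ∧ b = 1 then 1 else 0) - if a = 1 ∧ b = 0 then 1 else 0) := by
  fin_cases a <;> fin_cases b <;>
    simp [lagrangianForm, smulForm, basisForm, Matrix.det_fin_two]

theorem dV_lagrangianForm (L : FirstJet m → ℝ) (c : Fib m) (p : Jet m) :
    dV (lagrangianForm L) ![0, 1] ![c] p = pd (Sum.inr c) (fun p => L (toFirstJet p)) p := by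
  have h : ∀ C : Fin 0 → Fib m,
      lagrangianForm L ![0, 1] C = fun p => L (toFirstJet p) := fun C => by
    funext p; rw [lagrangianForm_apply]; simp
  simp [dV, h]

theorem dH_one_zero (f : Fin m → FirstJet m → ℝ) (B : Fin 2 → Jet m → ℝ) (a b : Fin 2)
    (C : Fin 0 → Fib m) (p : Jet m) :
    dH f (fun (I : Fin 1 → Fin 2) (_ : Fin 0 → Fib m) => B (I 0)) ![a, b] C p =
      totalD f a (B b) p - totalD f b (B a) p := by
  simp [dH, lieD, Fin.sum_univ_two, sub_eq_add_neg]

theorem isForm_one_zero {V : Set (FirstJet m)} {B : Fin 2 → Jet m → ℝ}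
    (hB : ∀ i, SmoothOver V (B i)) :
    IsForm V (fun (I : Fin 1 → Fin 2) (_ : Fin 0 → Fib m) => B (I 0)) where
  smooth I _ := hB (I 0)
  alt_hor σ I _ p _ := by simp [Subsingleton.elim σ 1]
  alt_vert σ I _ p _ := by simp [Subsingleton.elim σ 1]
  finite := ⟨∅, fun _ _ ⟨l, _⟩ => l.elim0⟩

theorem IsForm.exists_fib {V : Set (FirstJet m)} {η : BiForm m 1 1} (h : IsForm V η) :
    ∃ t : Finset (Fib m), ∀ i, ∀ c ∉ t, ∀ p ∈ jetsOver V, η ![i] ![c] p = 0 := by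
  obtain ⟨t, ht⟩ := h.finite
  exact ⟨t, fun i c hc => ht _ _ ⟨0, by simpa using hc⟩⟩

theorem IsForm.mono {r s : ℕ} {V W : Set (FirstJet m)} {η : BiForm m r s} (h : IsForm V η)
    (hWV : W ⊆ V) : IsForm W η where
  smooth I C := (h.smooth I C).mono hWV
  alt_hor σ I C p hp := h.alt_hor σ I C p (hWV hp)
  alt_vert σ I C p hp := h.alt_vert σ I C p (hWV hp)
  finite := h.finite.imp fun _ ht I C hC p hp => ht I C hC p (hWV hp)

/-- The common finite set matters: `∑ᶠ` is `0` on infinite support, so it is not additive in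
general. -/
theorem finsum_mul_sub {ι : Type*} (t : Finset ι) {a x y : ι → ℝ} (hx : ∀ e ∉ t, x e = 0)
    (hy : ∀ e ∉ t, y e = 0) :
    ∑ᶠ e, a e * (x e - y e) = ∑ᶠ e, a e * x e - ∑ᶠ e, a e * y e := by
  have hs : ∀ z : ι → ℝ, (∀ e ∉ t, z e = 0) → (Function.support fun e => a e * z e) ⊆ t :=
    fun z hz e he => by
      by_contra h
      exact he (by simp [hz e h])
  rw [finsum_eq_sum_of_support_subset _ (hs x hx), finsum_eq_sum_of_support_subset _ (hs y hy),
    finsum_eq_sum_of_support_subset _ (hs (fun e => x e - y e)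
      fun e he => by rw [hx e he, hy e he, sub_zero])]
  simp only [mul_sub, Finset.sum_sub_distrib]

theorem along_sub {V : Set (FirstJet m)} (hV : IsOpen V) (i : Fin 2) (v : Fib m → Jet m → ℝ)
    {F G : Jet m → ℝ} (hF : SmoothOver V F) (hG : SmoothOver V G) {p : Jet m}
    (hp : p ∈ jetsOver V) :
    along i v (fun p => F p - G p) p = along i v F p - along i v G p := by
  have h := along_add hV i v (hF.sub hG) hG hp
  simp only [sub_add_cancel] at h
  rw [eq_sub_iff_add_eq]
  exact h.symm

/-- A type `(1, 1)` form annihilated by `d_V` is `d_V`-exact over a convex set. -/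
theorem exists_vertical_primitive {V : Set (FirstJet m)} (hV : IsOpen V) (hc : Convex ℝ V)
    {ζ : Fib m → Jet m → ℝ} (hζ : ∀ c, SmoothOver V (ζ c)) {t : Finset (Fib m)}
    (hfin : ∀ c ∉ t, ∀ p ∈ jetsOver V, ζ c p = 0)
    (hclosed : ∀ c d, ∀ p ∈ jetsOver V, pd (Sum.inr c) (ζ d) p = pd (Sum.inr d) (ζ c) p) :
    ∃ B, SmoothOver V B ∧ ∀ c, ∀ p ∈ jetsOver V, pd (Sum.inr c) B p = ζ c p := by
  -- `x` and `y` are parameters; the components set to `0` along them play no role.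
  obtain ⟨B, hB, hBd⟩ := exists_primitive hV hc (range Sum.inr) (ζ := Sum.elim (fun _ _ => 0) ζ)
    (t₀ := t.image Sum.inr)
    (by rintro (i | c); exacts [smoothOver_const V 0, hζ c])
    (by
      rintro (i | c) h p hp
      exacts [rfl, hfin c (fun hc => h (Finset.mem_image_of_mem _ hc)) p hp])
    (by rintro _ ⟨c, rfl⟩ _ ⟨d, rfl⟩; exact hclosed c d)
  exact ⟨B, hB, fun c => hBd _ ⟨c, rfl⟩⟩

/-- Over a convex set, a function of `x` and `y` is the total `x`-derivative of such a function. -/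
theorem exists_x_primitive {V : Set (FirstJet m)} (hV : IsOpen V) (hc : Convex ℝ V)
    {H : Jet m → ℝ} (hH : SmoothOver V H)
    (hd : ∀ c, ∀ p ∈ jetsOver V, pd (Sum.inr c) H p = 0) (f : Fin m → FirstJet m → ℝ) :
    ∃ G, SmoothOver V G ∧ ∀ p ∈ jetsOver V, totalD f 0 G p = H p := by
  -- The form `H dx` is closed in `x` and the fibre coordinates, as `H` has no fibre derivatives;
  -- only `y` is a parameter. The resulting `G` has no fibre derivatives either, so `D_x G` is its
  -- plain `x`-derivative.
  obtain ⟨G, hG, hGd⟩ := exists_primitive hV hc ({Sum.inl 0} ∪ range Sum.inr)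
    (ζ := fun c => if c = Sum.inl 0 then H else fun _ => 0) (t₀ := {Sum.inl 0})
    (fun c => by
      split_ifs
      exacts [hH, smoothOver_const V 0])
    (fun c hc p _ => by simp at hc; simp [hc])
    (by
      rintro c (rfl | ⟨c, rfl⟩) d (rfl | ⟨d, rfl⟩) p hp
      · rfl
      · simp [hd d p hp, pd_const]
      · simp [hd c p hp, pd_const]
      · simp [pd_const])
  refine ⟨G, hG, fun p hp => ?_⟩
  have h0 : ∀ c, pd (Sum.inr c) G p = 0 := fun c => by
    rw [hGd (Sum.inr c) (by simp) p hp]; simp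
  rw [totalD, along_eq_sum (s := ∅) _ _ fun c _ => h0 c, hGd (Sum.inl 0) (by simp) p hp]
  simp

end FGordon

/-! ### The divergence relating the two Lagrangians. -/

theorem corollary6p2 (m : ℕ) (U : Set (FGordon.FirstJet m)) (hU : IsOpen U)
    (f : Fin m → FGordon.FirstJet m → ℝ) (hf : ∀ α, ContDiffOn ℝ ∞ (f α) U)
    (T S R : Fin m → Fin m → FGordon.Jet m → ℝ)
    (hT : ∀ α β, FGordon.SmoothOver U (T α β))
    (hS : ∀ α β, FGordon.SmoothOver U (S α β))
    (hR : ∀ α β, FGordon.SmoothOver U (R α β))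
    (hclosed : FGordon.DClosed f U (FGordon.omegaForm T S R))
    (L L' : FGordon.FirstJet m → ℝ)
    (hL : ContDiffOn ℝ ∞ L U) (hL' : ContDiffOn ℝ ∞ L' U)
    (η η' : FGordon.BiForm m 1 1)
    (hη : FGordon.IsForm U η) (hη' : FGordon.IsForm U η')
    (hHη : FGordon.EqOver U (FGordon.dH f η) (FGordon.dV (FGordon.lagrangianForm L)))
    (hHη' : FGordon.EqOver U (FGordon.dH f η') (FGordon.dV (FGordon.lagrangianForm L')))
    (hVη : FGordon.EqOver U (FGordon.dV η) (FGordon.omegaForm T S R))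
    (hVη' : FGordon.EqOver U (FGordon.dV η') (FGordon.omegaForm T S R))
    (V : Set (FGordon.FirstJet m)) (hV : IsOpen V) (hVconv : Convex ℝ V) (hVU : V ⊆ U) :
    ∃ β : FGordon.BiForm m 1 0, FGordon.IsForm V β ∧
      FGordon.EqOver V (FGordon.lagrangianForm L')
        (FGordon.lagrangianForm L + FGordon.dH f β) := by
  have hfV := fun α => (hf α).mono hVU
  have hsm := (hη.mono hVU).smooth
  have hsm' := (hη'.mono hVU).smooth
  obtain ⟨t, ht⟩ := (hη.mono hVU).exists_fib
  obtain ⟨t', ht'⟩ := (hη'.mono hVU).exists_fib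
  have h0 : ∀ i, ∀ e ∉ t ∪ t', ∀ p ∈ FGordon.jetsOver V, η ![i] ![e] p = 0 := fun i e he =>
    ht i e fun h => he (Finset.mem_union_left _ h)
  have h0' : ∀ i, ∀ e ∉ t ∪ t', ∀ p ∈ FGordon.jetsOver V, η' ![i] ![e] p = 0 := fun i e he =>
    ht' i e fun h => he (Finset.mem_union_right _ h)
  have hex : ∀ i : Fin 2, ∃ B, FGordon.SmoothOver V B ∧ ∀ c, ∀ p ∈ FGordon.jetsOver V,
      FGordon.pd (Sum.inr c) B p = η' ![i] ![c] p - η ![i] ![c] p := fun i =>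
    FGordon.exists_vertical_primitive hV hVconv
      (ζ := fun c p => η' ![i] ![c] p - η ![i] ![c] p) (t := t ∪ t')
      (fun c => (hsm' _ _).sub (hsm _ _))
      (fun c hc p hp => by rw [h0 i c hc p hp, h0' i c hc p hp, sub_zero])
      fun c d p hp => by
        rw [FGordon.pd_sub hV (hsm' _ _) (hsm _ _) _ hp, FGordon.pd_sub hV (hsm' _ _) (hsm _ _) _ hp]
        -- Both vertical differentials equal `ω`, so their components agree; this is the symmetry
        -- required of the difference.
        have h := (hVη ![i] ![c, d] p (hVU hp)).trans (hVη' ![i] ![c, d] p (hVU hp)).symm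
        rw [FGordon.dV_one_one, FGordon.dV_one_one] at h
        linarith
  choose B hB hBd using hex
  have hcomp := FGordon.smoothOver_comp hV hfV
  have hLs := FGordon.smoothOver_firstJet (hL.mono hVU)
  have hLs' := FGordon.smoothOver_firstJet (hL'.mono hVU)
  have hD : ∀ i j, FGordon.SmoothOver V (FGordon.totalD f i (B j)) := fun i j =>
    FGordon.smoothOver_along hV i (hcomp i) (hB j)
  -- The commutator term of `pd_along` is the term of `lieD` that acts on contact forms.
  have hpdD : ∀ i j c, ∀ p ∈ FGordon.jetsOver V,
      FGordon.pd (Sum.inr c) (FGordon.totalD f i (B j)) p =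
        FGordon.lieD f i η' ![j] ![c] p - FGordon.lieD f i η ![j] ![c] p := fun i j c p hp => by
    rw [FGordon.totalD, FGordon.pd_along hV i (hcomp i) (hB j) _ hp,
      FGordon.along_congr hV i _ (hBd j c) hp, FGordon.along_sub hV i _ (hsm' _ _) (hsm _ _) hp,
      FGordon.lieD_one_one, FGordon.lieD_one_one]
    simp only [hBd j _ p hp]
    rw [FGordon.finsum_mul_sub (t ∪ t') (fun e he => h0' j e he p hp) fun e he => h0 j e he p hp]
    simp only [FGordon.totalD]
    ring
  -- What remains of `L' - L` after subtracting the divergence of `B` has no fibre derivatives, by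
  -- the two equations for `d_H`.
  obtain ⟨G, hG, hGd⟩ := FGordon.exists_x_primitive hV hVconv
    ((hLs'.sub hLs).sub ((hD 0 1).sub (hD 1 0)))
    (fun c p hp => by
      rw [FGordon.pd_sub hV (hLs'.sub hLs) ((hD 0 1).sub (hD 1 0)) _ hp,
        FGordon.pd_sub hV hLs' hLs _ hp, FGordon.pd_sub hV (hD 0 1) (hD 1 0) _ hp,
        hpdD 0 1 c p hp, hpdD 1 0 c p hp]
      have h := hHη ![0, 1] ![c] p (hVU hp)
      have h' := hHη' ![0, 1] ![c] p (hVU hp)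
      rw [FGordon.dH_one_one, FGordon.dV_lagrangianForm] at h h'
      linarith) f
  -- `G` goes into the `dy` component because `d_H (G dy) = D_x G dx ∧ dy`.
  let β : Fin 2 → FGordon.Jet m → ℝ := ![B 0, fun p => B 1 p + G p]
  refine ⟨fun I _ => β (I 0), FGordon.isForm_one_zero fun i => ?_, fun I C p hp => ?_⟩
  · fin_cases i
    exacts [hB 0, (hB 1).add hG]
  · have hI : I = ![I 0, I 1] := by
      funext k; fin_cases k <;> rfl
    have key : FGordon.totalD f 0 (β 1) p - FGordon.totalD f 1 (β 0) p =
        L' (FGordon.toFirstJet p) - L (FGordon.toFirstJet p) := by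
      have h1 : FGordon.totalD f 0 (β 1) p = FGordon.totalD f 0 (B 1) p + FGordon.totalD f 0 G p :=
        FGordon.along_add hV 0 _ (hB 1) hG hp
      have h2 : FGordon.totalD f 1 (β 0) p = FGordon.totalD f 1 (B 0) p := rfl
      rw [h1, h2, hGd p hp]
      ring
    rw [hI, Pi.add_apply, Pi.add_apply, Pi.add_apply, FGordon.lagrangianForm_apply,
      FGordon.lagrangianForm_apply, FGordon.dH_one_zero]
    generalize I 0 = a
    generalize I 1 = b
    -- Repeated indices give zero on both sides; the two mixed orders are `key` and its negative.
    fin_cases a <;> fin_cases b <;> simp <;> linarith
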